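/- Say that a triple $(a,b,c)$ of non-negative integers satisfies the triangle condition if $a\le b+c$, $b\le a+c$, $c\le a+b$ and $a+b+c$ is even. For non-negative half-integers $x,y,z\in\tfrac12\mathbb{Z}_{\ge0}$ put $$\Delta(x,y,z)=\sqrt{\frac{(x+y-z)!\,(x-y+z)!\,(-x+y+z)!}{(x+y+z+1)!}}$$ if $(2x,2y,2z)$ satisfies the triangle condition, and $\Delta(x,y,z)=0$ otherwise. For $j_1,\dots,j_6\in\tfrac12\mathbb{Z}_{\ge0}$ the Racah–Wigner $6j$-symbol $\left\{\begin{matrix} j_1 & j_2 & j_3\\ j_4 & j_5 & j_6\end{matrix}\right\}$ is $0$ if one of the four triples $(2j_1,2j_2,2j_3)$, $(2j_1,2j_5,2j_6)$, $(2j_4,2j_2,2j_6)$, $(2j_4,2j_5,2j_3)$ does not satisfy the triangle condition; otherwise it is the real number $$\Delta(j_1,j_2,j_3)\Delta(j_3,j_4,j_5)\Delta(j_2,j_4,j_6)\Delta(j_1,j_5,j_6)\sum_t\frac{(-1)^t(t+1)!}{\prod_{i=0}^{3}(t-\alpha_i)!\,\prod_{i=1}^{3}(\beta_i-t)!},$$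 where $t$ runs from $\max_i\alpha_i$ to $\min_i\beta_i$ and $\alpha_0=j_1+j_2+j_3$, $\alpha_1=j_1+j_5+j_6$, $\alpha_2=j_4+j_2+j_6$, $\alpha_3=j_4+j_5+j_3$, $\beta_1=j_2+j_3+j_5+j_6$, $\beta_2=j_1+j_3+j_4+j_6$, $\beta_3=j_1+j_2+j_4+j_5$. **Lemma.** Let $j_1,\dots,j_6$ be non-negative half-integers such that $j_6=j_1+j_5$, $j_2=j_3$ and all the triples $$(2h,2j_2,2j_3),\quad (2h,2j_5,2j_6),\quad (2j_4,2j_2,2j_6),\quad (2j_4,2j_5,2j_3)$$ satisfy the triangle condition for $h=j_1$ and for $h=j_1+1$. If $$\left\{\begin{matrix} j_1+1 & j_2 & j_3\\ j_4 & j_5 & j_6\end{matrix}\right\}=0,$$ then $$\left\{\begin{matrix} j_1+2 & j_2 & j_3\\ j_4 & j_5 & j_6\end{matrix}\right\}\ne0\qquad\text{and}\qquad \left\{\begin{matrix} j_1+3 & j_2 & j_3\\ j_4 & j_5 & j_6\end{matrix}\right\}\ne0.$$ -/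

import Mathlib

open scoped Nat

/-- The triple `(a, b, c)` of non-negative integers satisfies the triangle condition: `a`, `b`, `c`
are the side lengths of a (possibly degenerate) triangle and `a + b + c` is even. -/
def TriangleCondition (a b c : ℕ) : Prop :=
  a ≤ b + c ∧ b ≤ a + c ∧ c ≤ a + b ∧ Even (a + b + c)

instance (a b c : ℕ) : Decidable (TriangleCondition a b c) :=
  inferInstanceAs (Decidable (_ ∧ _ ∧ _ ∧ _))

/-- `Δ(a/2, b/2, c/2)`; it is `0` if `(a, b, c)` does not satisfy the triangle condition. Under the
triangle condition none of the subtractions truncates and all the divisions are exact. -/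
noncomputable def triangleDelta (a b c : ℕ) : ℝ :=
  if TriangleCondition a b c then
    Real.sqrt ((((a + b - c) / 2)! * ((a + c - b) / 2)! * ((b + c - a) / 2)! : ℝ) /
      ((a + b + c) / 2 + 1)!)
  else 0

/-- The Racah-Wigner 6j-symbol with upper row `a₁/2, a₂/2, a₃/2` and lower row
`a₄/2, a₅/2, a₆/2`: the argument `aᵢ = 2 jᵢ` is twice the half-integer `jᵢ`.
It is `0` unless all of `(a₁, a₂, a₃)`, `(a₁, a₅, a₆)`, `(a₄, a₂, a₆)`, `(a₄, a₅, a₃)` satisfy the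
triangle condition. When they do, all the divisions by `2` below are exact, and
the subtractions do not truncate on the range of summation. -/
noncomputable def sixJ (a₁ a₂ a₃ a₄ a₅ a₆ : ℕ) : ℝ :=
  if TriangleCondition a₁ a₂ a₃ ∧ TriangleCondition a₁ a₅ a₆ ∧
      TriangleCondition a₄ a₂ a₆ ∧ TriangleCondition a₄ a₅ a₃ then
    let α₀ : ℕ := (a₁ + a₂ + a₃) / 2
    let α₁ : ℕ := (a₁ + a₅ + a₆) / 2
    let α₂ : ℕ := (a₄ + a₂ + a₆) / 2
    let α₃ : ℕ := (a₄ + a₅ + a₃) / 2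
    let β₁ : ℕ := (a₂ + a₃ + a₅ + a₆) / 2
    let β₂ : ℕ := (a₁ + a₃ + a₄ + a₆) / 2
    let β₃ : ℕ := (a₁ + a₂ + a₄ + a₅) / 2
    triangleDelta a₁ a₂ a₃ * triangleDelta a₃ a₄ a₅ * triangleDelta a₂ a₄ a₆ *
      triangleDelta a₁ a₅ a₆ *
      ∑ t ∈ Finset.Icc (max (max α₀ α₁) (max α₂ α₃)) (min (min β₁ β₂) β₃),
        (-1 : ℝ) ^ t * ((t + 1)! : ℝ) /
          ((t - α₀)! * (t - α₁)! * (t - α₂)! * (t - α₃)! *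
            (β₁ - t)! * (β₂ - t)! * (β₃ - t)! : ℝ)
  else 0

/-! The relations `j₂ = j₃`, `j₆ = j₁ + j₅` leave four integer parameters `p, q, r, m`, with `j₁ =
m`. For upper-left entry `m + k` the symbol is a nonzero factor times `stretchedSum p q r m k`, a
sum of at most `k + 1` nonzero terms. Put `X = pq` and `N = p + q + r + 2m + 2`. The sum for `k = 1`
vanishes iff `X = Nr`. This relation eliminates `N` and `r` from the sums for `k = 2, 3`: up to
positive denominators they become `-2XY` and `-(8m + 20)XY`, where `Y = X + (m + 1)(p + q + m + 1)`.
Both are negative since `X > 0`. -/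

theorem triangleDelta_pos {a b c : ℕ} (h : TriangleCondition a b c) : 0 < triangleDelta a b c := by
  rw [triangleDelta, if_pos h]
  positivity

/-- The alternating sum that governs the stretched 6j-symbol with
`j₁ = m + k`, `j₂ = j₃`, `j₆ = m + j₅`. -/
noncomputable def stretchedSum (p q r m k : ℕ) : ℝ :=
  ∑ i ∈ Finset.range (k + 1),
    (-1 : ℝ) ^ i * (k.choose i * (p + q + r + 2 * m + 2).ascFactorial i *
      p.descFactorial (k - i) * q.descFactorial (k - i) * r.descFactorial i : ℕ) /
      ((m + i)! * (m + (k - i))! : ℕ)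

/-! ### From the Racah sum to the stretched sum -/

theorem racah_term_eq {p q r m k i : ℕ} (hi : i ≤ k) (hp : k - i ≤ p) (hq : k - i ≤ q)
    (hr : i ≤ r) :
    ((p + q + r + 2 * m + 1 + i)! : ℝ) /
        ((p - (k - i))! * (q - (k - i))! * i ! * (m + i)! * (r - i)! * (m + (k - i))! * (k - i)!) =
      (p + q + r + 2 * m + 1)! / (p ! * q ! * r ! * k !) *
        ((k.choose i * (p + q + r + 2 * m + 2).ascFactorial i *
          p.descFactorial (k - i) * q.descFactorial (k - i) * r.descFactorial i : ℕ) /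
          ((m + i)! * (m + (k - i))! : ℕ)) := by
  rw [← Nat.factorial_mul_ascFactorial (p + q + r + 2 * m + 1) i,
    ← Nat.factorial_mul_descFactorial hp, ← Nat.factorial_mul_descFactorial hq,
    ← Nat.factorial_mul_descFactorial hr, ← Nat.choose_mul_factorial_mul_factorial hi]
  have h1 : (p.descFactorial (k - i) : ℝ) ≠ 0 := by
    rw [Nat.cast_ne_zero, Ne, Nat.descFactorial_eq_zero_iff_lt]; omega
  have h2 : (q.descFactorial (k - i) : ℝ) ≠ 0 := by
    rw [Nat.cast_ne_zero, Ne, Nat.descFactorial_eq_zero_iff_lt]; omega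
  have h3 : (r.descFactorial i : ℝ) ≠ 0 := by
    rw [Nat.cast_ne_zero, Ne, Nat.descFactorial_eq_zero_iff_lt]; omega
  have h4 : (k.choose i : ℝ) ≠ 0 := Nat.cast_ne_zero.2 (Nat.choose_pos hi).ne'
  have hf : ∀ n : ℕ, (n ! : ℝ) ≠ 0 := fun n => Nat.cast_ne_zero.2 n.factorial_ne_zero
  have f1 := hf (p - (k - i))
  have f2 := hf (q - (k - i))
  have f3 := hf (r - i)
  have f4 := hf i
  have f5 := hf (k - i)
  have f6 := hf (m + i)
  have f7 := hf (m + (k - i))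
  push_cast
  field_simp

/-- Substitute `t = p + q + r + 2m + i`. The range of `t` may give fewer than `k + 1` indices, but
at each missing `i` one of the falling factorials vanishes. -/
theorem racah_sum_eq (p q r m k : ℕ) :
    ∑ t ∈ Finset.Icc (max (max (q + r + 2 * m + k) (p + r + 2 * m + k))
        (max (p + q + r + 2 * m) (p + q + r + m)))
        (min (min (p + q + r + 2 * m + r) (p + q + r + 2 * m + m + k)) (p + q + r + 2 * m + k)),
      (-1 : ℝ) ^ t * ((t + 1)! : ℝ) /
        ((t - (q + r + 2 * m + k))! * (t - (p + r + 2 * m + k))! * (t - (p + q + r + 2 * m))! *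
          (t - (p + q + r + m))! * (p + q + r + 2 * m + r - t)! *
          (p + q + r + 2 * m + m + k - t)! * (p + q + r + 2 * m + k - t)! : ℝ) =
      (-1 : ℝ) ^ (p + q + r + 2 * m) *
        ((p + q + r + 2 * m + 1)! / (p ! * q ! * r ! * k !)) * stretchedSum p q r m k := by
  rw [stretchedSum, Finset.mul_sum]
  refine Finset.sum_of_injOn (fun t => t - (p + q + r + 2 * m)) ?_ ?_ ?_ ?_
  · intro s hs t ht hst
    simp only [Finset.coe_Icc, Set.mem_Icc] at hs ht hst
    omega
  · intro t ht
    simp only [Finset.coe_Icc, Set.mem_Icc, Finset.coe_range, Set.mem_Iio] at ht ⊢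
    omega
  · intro i hi hni
    rw [Finset.mem_range] at hi
    have hdeg : p < k - i ∨ q < k - i ∨ r < i := by
      by_contra! hcon
      refine hni ⟨p + q + r + 2 * m + i, ?_, by simp⟩
      simp only [Finset.coe_Icc, Set.mem_Icc]
      omega
    rcases hdeg with h | h | h <;> simp [Nat.descFactorial_of_lt h]
  · intro t ht
    rw [Finset.mem_Icc] at ht
    obtain ⟨i, rfl⟩ : ∃ i, t = p + q + r + 2 * m + i :=
      ⟨t - (p + q + r + 2 * m), by omega⟩
    have hi : i ≤ k := by omega
    have hp : k - i ≤ p := by omega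
    have hq : k - i ≤ q := by omega
    have hr : i ≤ r := by omega
    have e0 : p + q + r + 2 * m + i - (q + r + 2 * m + k) = p - (k - i) := by omega
    have e1 : p + q + r + 2 * m + i - (p + r + 2 * m + k) = q - (k - i) := by omega
    have e2 : p + q + r + 2 * m + i - (p + q + r + 2 * m) = i := by omega
    have e3 : p + q + r + 2 * m + i - (p + q + r + m) = m + i := by omega
    have e4 : p + q + r + 2 * m + r - (p + q + r + 2 * m + i) = r - i := by omega
    have e5 : p + q + r + 2 * m + m + k - (p + q + r + 2 * m + i) = m + (k - i) := by omega
    have e6 : p + q + r + 2 * m + k - (p + q + r + 2 * m + i) = k - i := by omega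
    have e7 : p + q + r + 2 * m + i + 1 = p + q + r + 2 * m + 1 + i := by omega
    simp only [e0, e1, e2, e3, e4, e5, e6, e7]
    rw [mul_div_assoc, racah_term_eq hi hp hq hr, pow_add]
    ring

theorem sixJ_stretched_eq_zero_iff {p q r m k : ℕ} (hpr : k ≤ p + r) (hqr : k ≤ q + r) :
    sixJ (2 * m + 2 * k) (q + r + m) (q + r + m) (p + q + m) (p + r) (2 * m + (p + r)) = 0 ↔
      stretchedSum p q r m k = 0 := by
  have t1 : TriangleCondition (2 * m + 2 * k) (q + r + m) (q + r + m) := by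
    refine ⟨?_, ?_, ?_, ?_⟩ <;> first | omega | (rw [Nat.even_iff]; omega)
  have t2 : TriangleCondition (2 * m + 2 * k) (p + r) (2 * m + (p + r)) := by
    refine ⟨?_, ?_, ?_, ?_⟩ <;> first | omega | (rw [Nat.even_iff]; omega)
  have t3 : TriangleCondition (p + q + m) (q + r + m) (2 * m + (p + r)) := by
    refine ⟨?_, ?_, ?_, ?_⟩ <;> first | omega | (rw [Nat.even_iff]; omega)
  have t4 : TriangleCondition (p + q + m) (p + r) (q + r + m) := by
    refine ⟨?_, ?_, ?_, ?_⟩ <;> first | omega | (rw [Nat.even_iff]; omega)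
  have t4' : TriangleCondition (q + r + m) (p + q + m) (p + r) := by
    refine ⟨?_, ?_, ?_, ?_⟩ <;> first | omega | (rw [Nat.even_iff]; omega)
  have t3' : TriangleCondition (q + r + m) (p + q + m) (2 * m + (p + r)) := by
    refine ⟨?_, ?_, ?_, ?_⟩ <;> first | omega | (rw [Nat.even_iff]; omega)
  rw [sixJ, if_pos ⟨t1, t2, t3, t4⟩]
  have d1 := (triangleDelta_pos t1).ne'
  have d2 := (triangleDelta_pos t2).ne'
  have d3 := (triangleDelta_pos t3').ne'
  have d4 := (triangleDelta_pos t4').ne'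
  have e0 : (2 * m + 2 * k + (q + r + m) + (q + r + m)) / 2 = q + r + 2 * m + k := by omega
  have e1 : (2 * m + 2 * k + (p + r) + (2 * m + (p + r))) / 2 = p + r + 2 * m + k := by omega
  have e2 : (p + q + m + (q + r + m) + (2 * m + (p + r))) / 2 = p + q + r + 2 * m := by omega
  have e3 : (p + q + m + (p + r) + (q + r + m)) / 2 = p + q + r + m := by omega
  have e4 : (q + r + m + (q + r + m) + (p + r) + (2 * m + (p + r))) / 2 =
      p + q + r + 2 * m + r := by omega
  have e5 : (2 * m + 2 * k + (q + r + m) + (p + q + m) + (2 * m + (p + r))) / 2 =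
      p + q + r + 2 * m + m + k := by omega
  have e6 : (2 * m + 2 * k + (q + r + m) + (p + q + m) + (p + r)) / 2 =
      p + q + r + 2 * m + k := by omega
  simp only [e0, e1, e2, e3, e4, e5, e6]
  rw [racah_sum_eq]
  have hC : (-1 : ℝ) ^ (p + q + r + 2 * m) *
      ((p + q + r + 2 * m + 1)! / (p ! * q ! * r ! * k !)) ≠ 0 := by positivity
  rw [mul_eq_zero_iff_left (mul_ne_zero (mul_ne_zero (mul_ne_zero d1 d4) d3) d2),
    mul_eq_zero_iff_left hC]

/-! ### The sums for `k = 1, 2, 3` with denominators cleared -/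

theorem stretchedSum_one_mul (p q r m : ℕ) :
    stretchedSum p q r m 1 * (m ! * m ! * (m + 1)) =
      p * q - (p + q + r + 2 * m + 2) * r := by
  have hm : (m ! : ℝ) ≠ 0 := Nat.cast_ne_zero.2 m.factorial_ne_zero
  have hm1 : (m + 1 : ℝ) ≠ 0 := by positivity
  simp [stretchedSum, Finset.sum_range_succ, Nat.factorial_succ, Nat.ascFactorial]
  field_simp
  ring

theorem cast_descFactorial_two_real (n : ℕ) : (n.descFactorial 2 : ℝ) = n * (n - 1) := by
  rcases n with _ | n
  · simp
  · simp [Nat.descFactorial_succ]; ring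

theorem cast_descFactorial_three_real (n : ℕ) :
    (n.descFactorial 3 : ℝ) = n * (n - 1) * (n - 2) := by
  rcases n with _ | _ | n
  · simp
  · simp
  · simp [Nat.descFactorial_succ]; ring

theorem stretchedSum_two_mul (p q r m : ℕ) :
    stretchedSum p q r m 2 * (m ! * m ! * ((m + 1) ^ 2 * (m + 2))) =
      (m + 1) * (p * (p - 1) * (q * (q - 1))) -
        2 * (m + 2) * ((p + q + r + 2 * m + 2) * (p * q * r)) +
        (m + 1) * ((p + q + r + 2 * m + 2) * (p + q + r + 2 * m + 3) * (r * (r - 1))) := by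
  have hm : (m ! : ℝ) ≠ 0 := Nat.cast_ne_zero.2 m.factorial_ne_zero
  have hm1 : (m + 1 : ℝ) ≠ 0 := by positivity
  have hm2 : (m + 1 + 1 : ℝ) ≠ 0 := by positivity
  simp only [stretchedSum, Finset.sum_range_succ, Finset.sum_range_zero, Nat.ascFactorial,
    Nat.cast_mul, Nat.reduceSub, cast_descFactorial_two_real, Nat.descFactorial_one,
    Nat.descFactorial_zero, Nat.factorial_succ, Nat.reduceAdd, Nat.choose, add_zero, Nat.sub_zero]
  push_cast
  field_simp
  ring

theorem stretchedSum_three_mul (p q r m : ℕ) :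
    stretchedSum p q r m 3 * (m ! * m ! * ((m + 1) ^ 2 * (m + 2) * (m + 3))) =
      (m + 1) * (p * (p - 1) * (p - 2) * (q * (q - 1) * (q - 2))) -
        3 * (m + 3) * ((p + q + r + 2 * m + 2) * (p * (p - 1) * (q * (q - 1)) * r)) +
        3 * (m + 3) * ((p + q + r + 2 * m + 2) * (p + q + r + 2 * m + 3) *
          (p * q * (r * (r - 1)))) -
        (m + 1) * ((p + q + r + 2 * m + 2) * (p + q + r + 2 * m + 3) * (p + q + r + 2 * m + 4) *
          (r * (r - 1) * (r - 2))) := by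
  have hm : (m ! : ℝ) ≠ 0 := Nat.cast_ne_zero.2 m.factorial_ne_zero
  have hm1 : (m + 1 : ℝ) ≠ 0 := by positivity
  have hm2 : (m + 1 + 1 : ℝ) ≠ 0 := by positivity
  have hm3 : (m + 1 + 1 + 1 : ℝ) ≠ 0 := by positivity
  simp only [stretchedSum, Finset.sum_range_succ, Finset.sum_range_zero, Nat.ascFactorial,
    Nat.cast_mul, Nat.reduceSub, cast_descFactorial_two_real, cast_descFactorial_three_real,
    Nat.descFactorial_one, Nat.descFactorial_zero, Nat.factorial_succ, Nat.reduceAdd, Nat.choose,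
    add_zero, Nat.sub_zero]
  push_cast
  field_simp
  ring

/-! ### Consequences of vanishing at `k = 1` -/

theorem stretchedSum_one_eq_zero_iff {p q r m : ℕ} :
    stretchedSum p q r m 1 = 0 ↔ p * q = (p + q + r + 2 * m + 2) * r := by
  rw [← mul_left_inj' (show (m ! * m ! * (m + 1) : ℝ) ≠ 0 by positivity),
    stretchedSum_one_mul, zero_mul, sub_eq_zero]
  norm_cast

/-- Expanding `(N + 1)(r - 1) = Nr - (N - r) - 1` shows that the shifted product depends only on
`pq`, `p + q` and `m`. -/
theorem mul_pred_eq {p q r m : ℝ} (h : p * q = (p + q + r + 2 * m + 2) * r) :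
    (p + q + r + 2 * m + 3) * (r - 1) = p * q - (p + q + 2 * m + 2) - 1 := by
  linear_combination -h

theorem stretchedSum_two_ne_zero {p q r m : ℕ} (hX : 0 < p * q)
    (h : p * q = (p + q + r + 2 * m + 2) * r) : stretchedSum p q r m 2 ≠ 0 := by
  have hX' : (0 : ℝ) < p * q := by exact_mod_cast hX
  have h' : (p * q : ℝ) = (p + q + r + 2 * m + 2) * r := by exact_mod_cast h
  have hS := stretchedSum_two_mul p q r m
  have e : (m + 1 : ℝ) * (p * (p - 1) * (q * (q - 1))) -
        2 * (m + 2) * ((p + q + r + 2 * m + 2) * (p * q * r)) +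
        (m + 1) * ((p + q + r + 2 * m + 2) * (p + q + r + 2 * m + 3) * (r * (r - 1))) =
      -(2 * (p * q) * (p * q + (m + 1) * (p + q + m + 1))) := by
    have h1 : (p + q + r + 2 * m + 2 : ℝ) * (p * q * r) = (p * q) * (p * q) := by
      linear_combination -(p * q : ℝ) * h'
    have h2 : (p + q + r + 2 * m + 2 : ℝ) * (p + q + r + 2 * m + 3) * (r * (r - 1)) =
        (p * q) * (p * q - (p + q + 2 * m + 2) - 1) := by
      rw [← mul_pred_eq h']
      linear_combination -((p + q + r + 2 * m + 3) * (r - 1) : ℝ) * h'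
    rw [h1, h2]
    ring
  intro h0
  rw [h0, zero_mul, e] at hS
  have : (0 : ℝ) < 2 * (p * q) * (p * q + (m + 1) * (p + q + m + 1)) := by positivity
  linarith

theorem stretchedSum_three_ne_zero {p q r m : ℕ} (hX : 0 < p * q)
    (h : p * q = (p + q + r + 2 * m + 2) * r) : stretchedSum p q r m 3 ≠ 0 := by
  have hX' : (0 : ℝ) < p * q := by exact_mod_cast hX
  have h' : (p * q : ℝ) = (p + q + r + 2 * m + 2) * r := by exact_mod_cast h
  have hS := stretchedSum_three_mul p q r m
  have e : (m + 1 : ℝ) * (p * (p - 1) * (p - 2) * (q * (q - 1) * (q - 2))) -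
        3 * (m + 3) * ((p + q + r + 2 * m + 2) * (p * (p - 1) * (q * (q - 1)) * r)) +
        3 * (m + 3) * ((p + q + r + 2 * m + 2) * (p + q + r + 2 * m + 3) *
          (p * q * (r * (r - 1)))) -
        (m + 1) * ((p + q + r + 2 * m + 2) * (p + q + r + 2 * m + 3) * (p + q + r + 2 * m + 4) *
          (r * (r - 1) * (r - 2))) =
      -((p * q) * (p * q * (8 * m + 20) + (m + 1) * (p + q + m + 1) * (8 * m + 20))) := by
    have h1 : (p + q + r + 2 * m + 2 : ℝ) * (p * (p - 1) * (q * (q - 1)) * r) =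
        (p * q) * (p * q) * ((p - 1) * (q - 1)) := by
      linear_combination -(p * q * ((p - 1) * (q - 1)) : ℝ) * h'
    have h2 : (p + q + r + 2 * m + 2 : ℝ) * (p + q + r + 2 * m + 3) * (p * q * (r * (r - 1))) =
        (p * q) * (p * q) * (p * q - (p + q + 2 * m + 2) - 1) := by
      rw [← mul_pred_eq h']
      linear_combination -(p * q * ((p + q + r + 2 * m + 3) * (r - 1)) : ℝ) * h'
    -- The next shift: `(N + 2)(r - 2) = Nr - 2(N - r) - 4`.
    have h4 : (p + q + r + 2 * m + 4 : ℝ) * (r - 2) = p * q - 2 * (p + q + 2 * m + 2) - 4 := by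
      linear_combination -h'
    have h3 : (p + q + r + 2 * m + 2 : ℝ) * (p + q + r + 2 * m + 3) * (p + q + r + 2 * m + 4) *
          (r * (r - 1) * (r - 2)) =
        (p * q) * (p * q - (p + q + 2 * m + 2) - 1) *
          (p * q - 2 * (p + q + 2 * m + 2) - 4) := by
      rw [← mul_pred_eq h', ← h4]
      linear_combination -((p + q + r + 2 * m + 3) * (r - 1) *
        ((p + q + r + 2 * m + 4) * (r - 2)) : ℝ) * h'
    rw [h1, h2, h3]
    ring
  intro h0
  rw [h0, zero_mul, e] at hS
  have : (0 : ℝ) < (p * q) *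
      (p * q * (8 * m + 20) + (m + 1) * (p + q + m + 1) * (8 * m + 20)) := by positivity
  linarith

/-- Here `aᵢ = 2 jᵢ`, so that adding `1` to `j₁` is adding `2` to `a₁`. -/
theorem mainTheorem8 (a₁ a₂ a₃ a₄ a₅ a₆ : ℕ) (h₆ : a₆ = a₁ + a₅) (h₂₃ : a₂ = a₃)
    (hT : ∀ h : ℕ, h = a₁ ∨ h = a₁ + 2 →
      TriangleCondition h a₂ a₃ ∧ TriangleCondition h a₅ a₆ ∧
      TriangleCondition a₄ a₂ a₆ ∧ TriangleCondition a₄ a₅ a₃)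
    (h0 : sixJ (a₁ + 2) a₂ a₃ a₄ a₅ a₆ = 0) :
    sixJ (a₁ + 4) a₂ a₃ a₄ a₅ a₆ ≠ 0 ∧ sixJ (a₁ + 6) a₂ a₃ a₄ a₅ a₆ ≠ 0 := by
  obtain ⟨p, q, r, m, hpr, hqr, rfl, rfl, rfl, rfl⟩ : ∃ p q r m : ℕ, 1 ≤ p + r ∧ 1 ≤ q + r ∧
      a₁ = 2 * m ∧ a₂ = q + r + m ∧ a₄ = p + q + m ∧ a₅ = p + r := by
    -- The conditions at `j₁ + 1` suffice, and they give the bounds `1 ≤ p + r` and `1 ≤ q + r`.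
    obtain ⟨⟨u1, u2, u3, u4⟩, ⟨u5, u6, u7, u8⟩, ⟨u9, u10, u11, u12⟩, u13, u14, u15, u16⟩ :=
      hT (a₁ + 2) (Or.inr rfl)
    rw [Nat.even_iff] at u4 u8 u12 u16
    exact ⟨(a₄ + a₅ - a₂) / 2, (a₄ + a₂ - a₆) / 2, (a₂ + a₅ - a₄) / 2, a₁ / 2,
      by omega, by omega, by omega, by omega, by omega, by omega⟩
  subst h₆ h₂₃
  have h1 : p * q = (p + q + r + 2 * m + 2) * r :=
    stretchedSum_one_eq_zero_iff.1 ((sixJ_stretched_eq_zero_iff hpr hqr).1 h0)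
  have hr : 0 < r := by
    rcases Nat.eq_zero_or_pos r with rfl | hr
    · rcases mul_eq_zero.1 h1 <;> omega
    · exact hr
  have hX : 0 < p * q := by rw [h1]; positivity
  -- If `p ≤ r` then `pq ≤ rq < Nr`. With `r ≥ 1`, `r < p` gives `p + r ≥ 3`, and likewise `q + r ≥
  -- 3`, so the triangle conditions persist up to `k = 3`.
  have hp : r < p := by
    by_contra! hle
    nlinarith [Nat.mul_le_mul_right q hle]
  have hq : r < q := by
    by_contra! hle
    nlinarith [Nat.mul_le_mul_left p hle]
  exact ⟨fun h => stretchedSum_two_ne_zero hX h1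
      ((sixJ_stretched_eq_zero_iff (k := 2) (by omega) (by omega)).1 h),
    fun h => stretchedSum_three_ne_zero hX h1
      ((sixJ_stretched_eq_zero_iff (k := 3) (by omega) (by omega)).1 h)⟩
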